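/- Let $V$ be a finite set of $n$ players and let $\alpha>0$, $\beta>1$ be real numbers. In the penalized network creation game (PCG), a strategy of player $i\in V$ is a set $s_i\subseteq V\setminus\{i\}$ of players to whom $i$ builds an edge. A state $s=(s_i)_{i\in V}$ induces the undirected graph $G_s$ on $V$ in which $i$ and $j$ are adjacent if and only if $j\in s_i$ or $i\in s_j$. The cost of player $i$ is \[ c_i(s)=\alpha\,|s_i|+\sum_{j\ne i}\mathrm{dist}_s(i,j), \] where $\mathrm{dist}_s(i,j)$ is the length of a shortest path between $i$ and $j$ in $G_s$ if they lie in the same component, and $\mathrm{dist}_s(i,j)=\beta$ otherwise. The social cost is $c(s)=\sum_{i\in V}c_i(s)$, and a social optimum is a state of minimum social cost. A state $s$ is a strong equilibrium (SE) if no nonempty coalition of players has a joint change of its members' strategies, with all other strategies unchanged, that strictly decreases the cost of every member. **Theorem.** The price of anarchy for strong equilibria in the PCG is at most $4$: for every finite player set $V$ and all $\alpha>0$, $\beta>1$, every strong equilibrium $s$ and every social optimum $s^*$ satisfy $c(s)\le 4\,c(s^*)$. -/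

import Mathlib

namespace PCG

variable {V : Type*}

/-- A strategy of player `i`: the set of other players to which `i` builds (and pays for) an
edge. -/
abbrev Strategy (i : V) : Type _ := {S : Finset V // i ∉ S}

/-- A state (strategy vector): one strategy for every player. -/
abbrev State (V : Type*) : Type _ := (i : V) → Strategy i

/-- The undirected graph induced by a state: `i` and `j` are adjacent if at least one of them
builds the edge between them. -/
def graph (s : State V) : SimpleGraph V where
  Adj i j := j ∈ (s i).1 ∨ i ∈ (s j).1
  symm := ⟨fun _ _ h => h.symm⟩
  loopless := ⟨fun i h => h.elim (s i).2 (s i).2⟩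

open Classical in
/-- The distance in the penalized game: the length of a shortest path if the two players are in
the same component, and the penalty `β` otherwise. -/
noncomputable def penDist (β : ℝ) (s : State V) (i j : V) : ℝ :=
  if (graph s).Reachable i j then ((graph s).dist i j : ℝ) else β

/-- The individual cost of player `i`: `α` for every edge that `i` builds, plus the sum of the
distances to all other players. -/
noncomputable def playerCost [Fintype V] [DecidableEq V] (α β : ℝ) (s : State V) (i : V) : ℝ :=
  α * ((s i).1.card : ℝ) + ∑ j ∈ Finset.univ.erase i, penDist β s i j

/-- The social cost of a state: the sum of all individual costs. -/
noncomputable def socialCost [Fintype V] [DecidableEq V] (α β : ℝ) (s : State V) : ℝ :=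
  ∑ i, playerCost α β s i

/-- A social optimum: a state of minimum social cost. -/
def IsSocialOptimum [Fintype V] [DecidableEq V] (α β : ℝ) (s : State V) : Prop :=
  ∀ t : State V, socialCost α β s ≤ socialCost α β t

/-- A strong equilibrium: no coalition `C` has a joint deviation (a state `s'` that agrees with
`s` outside `C`) which strictly decreases the cost of each of its members. That is, if some member
of `C` strictly profits, then another member does not. -/
def IsStrongEquilibrium [Fintype V] [DecidableEq V] (α β : ℝ) (s : State V) : Prop :=
  ∀ (C : Finset V) (s' : State V), (∀ i, i ∉ C → s' i = s i) →
    (∃ i ∈ C, playerCost α β s' i < playerCost α β s i) →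
      ∃ j ∈ C, playerCost α β s j ≤ playerCost α β s' j

end PCG

namespace PCG

open Finset

/-! ### Shortest-path forests -/

section Graphs

variable {V : Type*} {G H : SimpleGraph V}

/-! With `n` players, an equilibrium is compared with three networks: empty, star and complete.
Their costs are `n(n-1)β`, `(n-1)(α+2(n-1))` and `n(n-1)(1+α/2)`, and the equilibrium costs at most
four times each (`socialCost_le_empty`, `socialCost_le_star`, `socialCost_le_complete`).

For the first two, a coalition threatens to dissolve a component or to build a star. Some member `v`
does not gain, so the sum of distances from `v` is small. By `playerCost_le_of_isRootMap`, no player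
pays much more than for keeping its share of a shortest-path forest and linking to such a root. For
the complete network, unilateral links bound every distance by `2 + α`.

It remains to bound an arbitrary state from below. If `α ≤ 2` and `1 + α/2 ≤ β`, or if `β ≤ 2`,
every pair of players costs at least as much as in the complete, respectively the empty, network.
Otherwise `α, β ≥ 2`, and `IsRootMap.le_socialCost` gives a bound affine in the number `m` of forest
edges, equal to the empty cost at `m = 0` and to the star cost at `m = n - 1`. Hence it is a convex
combination of the two. -/

theorem mem_of_reachable_of_closed {S : Set V} (hS : ∀ x ∈ S, ∀ y, G.Adj x y → y ∈ S) {u w : V}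
    (h : G.Reachable u w) (hu : u ∈ S) : w ∈ S := by
  obtain ⟨q⟩ := h
  induction q with
  | nil => exact hu
  | cons hadj _ ih => exact ih (hS _ hu _ hadj)

theorem reachable_of_reachable_of_adj (hGH : ∀ x y, H.Adj x y → G.Reachable x y) {u w : V}
    (h : H.Reachable u w) : G.Reachable u w :=
  mem_of_reachable_of_closed (S := {x | G.Reachable u x})
    (fun x hx y hxy => SimpleGraph.Reachable.trans hx (hGH x y hxy)) h (SimpleGraph.Reachable.refl u)

theorem exists_adj_dist_add_one {v w : V} (h : G.Reachable w v) (hne : w ≠ v) :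
    ∃ x, G.Adj w x ∧ G.dist v x + 1 = G.dist v w := by
  obtain ⟨q, hq⟩ := h.exists_walk_length_eq_dist
  cases q with
  | nil => exact absurd rfl hne
  | @cons _ x _ hadj q =>
    refine ⟨x, hadj, ?_⟩
    rw [SimpleGraph.Walk.length_cons] at hq
    rw [SimpleGraph.dist_comm (u := v) (v := w), ← hq, SimpleGraph.dist_comm]
    have h1 := SimpleGraph.dist_le q
    obtain ⟨q', hq'⟩ := q.reachable.exists_walk_length_eq_dist
    have h2 := SimpleGraph.dist_le (SimpleGraph.Walk.cons hadj q')
    rw [SimpleGraph.Walk.length_cons] at h2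
    omega

/-- A choice of one root in every connected component. -/
structure IsRootMap (G : SimpleGraph V) (r : V → V) : Prop where
  reachable : ∀ u, G.Reachable u (r u)
  eq_of_reachable : ∀ u w, G.Reachable u w → r u = r w

/-- A choice of a neighbour closer to the root for every vertex that is not a root. -/
structure IsParentMap (G : SimpleGraph V) (r p : V → V) : Prop where
  adj : ∀ w, w ≠ r w → G.Adj w (p w)
  dist : ∀ w, w ≠ r w → G.dist (r w) (p w) + 1 = G.dist (r w) w

theorem IsRootMap.exists_isParentMap {r : V → V} (hr : IsRootMap G r) :
    ∃ p, IsParentMap G r p := by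
  have h : ∀ w, ∃ x, w ≠ r w → G.Adj w x ∧ G.dist (r w) x + 1 = G.dist (r w) w := fun w => by
    by_cases hw : w = r w
    · exact ⟨w, fun h => absurd hw h⟩
    · obtain ⟨x, hx⟩ := exists_adj_dist_add_one (hr.reachable w) hw
      exact ⟨x, fun _ => hx⟩
  choose p hp using h
  exact ⟨p, fun w hw => (hp w hw).1, fun w hw => (hp w hw).2⟩

theorem exists_isRootMap (P : V → Prop) (hP : ∀ u, ∃ v, G.Reachable u v ∧ P v) :
    ∃ r, IsRootMap G r ∧ ∀ u, P (r u) := by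
  have h : ∀ c : G.ConnectedComponent, ∃ v, G.connectedComponentMk v = c ∧ P v := fun c => by
    induction c using SimpleGraph.ConnectedComponent.ind with
    | _ u =>
      obtain ⟨v, hv, hPv⟩ := hP u
      exact ⟨v, SimpleGraph.ConnectedComponent.sound hv.symm, hPv⟩
  choose f hf using h
  refine ⟨fun u => f (G.connectedComponentMk u), ⟨fun u => ?_, fun u w huw => ?_⟩, fun u => (hf _).2⟩
  · exact SimpleGraph.ConnectedComponent.exact (hf (G.connectedComponentMk u)).1.symm
  · exact congrArg f (SimpleGraph.ConnectedComponent.sound huw)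

theorem IsRootMap.root_root {r : V → V} (hr : IsRootMap G r) (u : V) : r (r u) = r u :=
  (hr.eq_of_reachable _ _ (hr.reachable u)).symm

theorem IsParentMap.exists_walk {r p : V → V} (hr : IsRootMap G r) (hp : IsParentMap G r p)
    (hH : ∀ w, w ≠ r w → H.Adj w (p w)) (w : V) :
    ∃ q : H.Walk (r w) w, q.length = G.dist (r w) w := by
  induction hd : G.dist (r w) w generalizing w with
  | zero =>
    have h : r w = w := (hr.reachable w).symm.dist_eq_zero_iff.1 hd
    rw [h]
    exact ⟨.nil, rfl⟩
  | succ d ih =>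
    have hw : w ≠ r w := fun h => by
      rw [← h, SimpleGraph.dist_self] at hd
      omega
    have hrp : r (p w) = r w := (hr.eq_of_reachable _ _ (hp.adj w hw).reachable).symm
    have hdist := hp.dist w hw
    have hq := ih (p w) (by rw [hrp]; omega)
    rw [hrp] at hq
    obtain ⟨q, hq⟩ := hq
    exact ⟨q.concat (hH w hw).symm, by rw [SimpleGraph.Walk.length_concat, hq]⟩

end Graphs

/-! ### Penalized distances and modified states -/

section Game

variable {V : Type*} {α β : ℝ} {s t : State V}

theorem penDist_of_not_reachable {i j : V} (h : ¬ (graph s).Reachable i j) :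
    penDist β s i j = β := if_neg h

theorem penDist_of_reachable {i j : V} (h : (graph s).Reachable i j) :
    penDist β s i j = (graph s).dist i j := if_pos h

theorem penDist_self (i : V) : penDist β s i i = 0 := by
  rw [penDist_of_reachable (SimpleGraph.Reachable.refl i), SimpleGraph.dist_self, Nat.cast_zero]

theorem penDist_le_length {i j : V} (q : (graph s).Walk i j) : penDist β s i j ≤ q.length := by
  rw [penDist_of_reachable q.reachable]
  exact_mod_cast SimpleGraph.dist_le q

theorem penDist_nonneg (hβ : 1 < β) (i j : V) : 0 ≤ penDist β s i j := by
  unfold penDist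
  split_ifs <;> [positivity; linarith]

theorem one_le_penDist (hβ : 1 < β) {i j : V} (h : i ≠ j) : 1 ≤ penDist β s i j := by
  by_cases hij : (graph s).Reachable i j
  · rw [penDist_of_reachable hij]
    exact_mod_cast hij.pos_dist_of_ne h
  · rw [penDist_of_not_reachable hij]
    exact hβ.le

theorem two_le_dist_of_not_adj {G : SimpleGraph V} {i j : V} (h : i ≠ j) (hij : G.Reachable i j)
    (hadj : ¬ G.Adj i j) : 2 ≤ G.dist i j := by
  have h0 := hij.pos_dist_of_ne h
  have h1 : G.dist i j ≠ 1 := fun h => hadj (SimpleGraph.dist_eq_one_iff_adj.1 h)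
  omega

/-- For every edge to a parent, `b` is an endpoint that builds it and `o` is the other one. -/
theorem IsParentMap.exists_builder {r p : V → V} (hp : IsParentMap (graph s) r p) :
    ∃ b o : V → V, ∀ w, w ≠ r w →
      o w ∈ (s (b w)).1 ∧ (b w = w ∧ o w = p w ∨ b w = p w ∧ o w = w) := by
  have h : ∀ w, ∃ x y, w ≠ r w → y ∈ (s x).1 ∧ (x = w ∧ y = p w ∨ x = p w ∧ y = w) := fun w => by
    by_cases hw : w = r w
    · exact ⟨w, w, fun h => absurd hw h⟩
    · rcases hp.adj w hw with h | h
      · exact ⟨w, p w, fun _ => ⟨h, Or.inl ⟨rfl, rfl⟩⟩⟩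
      · exact ⟨p w, w, fun _ => ⟨h, Or.inr ⟨rfl, rfl⟩⟩⟩
  choose b o hbo using h
  exact ⟨b, o, hbo⟩

variable [DecidableEq V]

theorem graph_update_adj {u : V} {S : Strategy u} {x y : V} :
    (graph (Function.update s u S)).Adj x y ↔
      (if x = u then y ∈ S.1 else y ∈ (s x).1) ∨ (if y = u then x ∈ S.1 else x ∈ (s y).1) := by
  have h : ∀ a b, b ∈ (Function.update s u S a).1 ↔ (if a = u then b ∈ S.1 else b ∈ (s a).1) := by
    intro a b
    by_cases ha : a = u
    · subst ha
      simp
    · simp [ha]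
  exact or_congr (h x y) (h y x)

/-- The star in which every other player builds an edge to the centre `c`. -/
def starState (c : V) : State V := fun i =>
  if h : i = c then ⟨∅, notMem_empty i⟩ else ⟨{c}, fun hi => h (mem_singleton.1 hi)⟩

theorem starState_adj {c i : V} (h : i ≠ c) : (graph (starState c)).Adj i c :=
  Or.inl (by simp [starState, h])

/-- The state in which `u` additionally builds an edge to `v`. -/
def link (s : State V) (u v : V) (h : u ≠ v) : State V :=
  Function.update s u ⟨insert v (s u).1, fun hu => (mem_insert.1 hu).elim h (s u).2⟩

theorem adj_link (s : State V) {u v : V} (h : u ≠ v) : (graph (link s u v h)).Adj u v := by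
  rw [link, graph_update_adj]
  simp

theorem graph_le_link (s : State V) {u v : V} (h : u ≠ v) : graph s ≤ graph (link s u v h) := by
  intro x y hxy
  rw [link, graph_update_adj]
  refine hxy.imp (fun hx => ?_) (fun hy => ?_)
  · split_ifs with hxu
    · exact mem_insert_of_mem (hxu ▸ hx)
    · exact hx
  · split_ifs with hyu
    · exact mem_insert_of_mem (hyu ▸ hy)
    · exact hy

theorem reachable_or_of_reachable_link {u v w : V} (h : u ≠ v)
    (hw : (graph (link s u v h)).Reachable u w) :
    (graph s).Reachable u w ∨ (graph s).Reachable v w := by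
  refine mem_of_reachable_of_closed
    (S := {x | (graph s).Reachable u x ∨ (graph s).Reachable v x}) ?_ hw
    (Or.inl (SimpleGraph.Reachable.refl u))
  intro x hx y hxy
  have hstep : (graph s).Adj x y → (graph s).Reachable u y ∨ (graph s).Reachable v y := fun h =>
    hx.imp (fun h' => h'.trans h.reachable) (fun h' => h'.trans h.reachable)
  rw [link, graph_update_adj] at hxy
  rcases hxy with hxy | hxy
  · split_ifs at hxy with hxu
    · rcases mem_insert.1 hxy with rfl | hxy
      · exact Or.inr (SimpleGraph.Reachable.refl _)
      · exact hstep (Or.inl (hxu ▸ hxy))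
    · exact hstep (Or.inl hxy)
  · split_ifs at hxy with hyu
    · rw [hyu]
      exact Or.inl (SimpleGraph.Reachable.refl _)
    · exact hstep (Or.inr hxy)

theorem penDist_link_le {u v w : V} (h : u ≠ v) (hw : (graph s).Reachable u w) :
    penDist β (link s u v h) u w ≤ penDist β s u w := by
  obtain ⟨q, hq⟩ := hw.exists_walk_length_eq_dist
  rw [penDist_of_reachable hw, ← hq, ← SimpleGraph.Walk.length_mapLe (graph_le_link s h) q]
  exact penDist_le_length _

variable [Fintype V]

/-! ### Player costs and the root-linking deviation -/

theorem playerCost_eq (i : V) :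
    playerCost α β s i = α * ((s i).1.card : ℝ) + ∑ j, penDist β s i j := by
  rw [playerCost, ← Finset.add_sum_erase _ _ (mem_univ i), penDist_self, zero_add]

theorem sum_penDist_le_playerCost (hα : 0 < α) (i : V) :
    ∑ j, penDist β s i j ≤ playerCost α β s i := by
  rw [playerCost_eq]
  have : 0 ≤ α * ((s i).1.card : ℝ) := by positivity
  linarith

theorem IsStrongEquilibrium.exists_le (hs : IsStrongEquilibrium α β s) {C : Finset V}
    (hC : C.Nonempty) (s' : State V) (h : ∀ i, i ∉ C → s' i = s i) :
    ∃ j ∈ C, playerCost α β s j ≤ playerCost α β s' j := by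
  obtain ⟨i, hi⟩ := hC
  rcases lt_or_ge (playerCost α β s' i) (playerCost α β s i) with hlt | hge
  · exact hs C s' h ⟨i, hi, hlt⟩
  · exact ⟨i, hi, hge⟩

theorem IsStrongEquilibrium.le_update (hs : IsStrongEquilibrium α β s) (u : V) (S : Strategy u) :
    playerCost α β s u ≤ playerCost α β (Function.update s u S) u := by
  obtain ⟨j, hj, h⟩ := hs.exists_le (singleton_nonempty u) (Function.update s u S)
    (fun i hi => Function.update_of_ne (by simpa using hi) _ _)
  rwa [mem_singleton.1 hj] at h

theorem sum_card_univ_erase (u : V) (c : ℝ) :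
    ∑ _w ∈ univ.erase u, c = ((Fintype.card V : ℝ) - 1) * c := by
  rw [sum_const, card_erase_of_mem (mem_univ u), nsmul_eq_mul, card_univ,
    Nat.cast_sub (Fintype.card_pos_iff.2 ⟨u⟩), Nat.cast_one]

/-- Linking every player to its root while keeping only a rooted spanning forest bounds the cost
of every player in an equilibrium. -/
theorem IsStrongEquilibrium.playerCost_le_of_isRootMap (hs : IsStrongEquilibrium α β s)
    (hα : 0 < α) (hβ : 1 < β) {r : V → V} (hr : IsRootMap (graph s) r) :
    ∃ k : V → ℕ, ∑ u, k u = #{w | w ≠ r w} ∧ ∀ u, playerCost α β s u ≤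
      α * (k u + if u ≠ r u then 1 else 0) +
        ((Fintype.card V : ℝ) - 1) * (if u ≠ r u then 1 else 0) + ∑ w, penDist β s (r u) w := by
  obtain ⟨p, hp⟩ := hr.exists_isParentMap
  obtain ⟨b, o, hbo⟩ := hp.exists_builder
  refine ⟨fun u => #{w | w ≠ r w ∧ b w = u}, ?_, fun u => ?_⟩
  · rw [card_eq_sum_card_fiberwise (f := b) (t := univ) (fun _ _ => mem_coe.2 (mem_univ _))]
    exact sum_congr rfl fun u _ => by rw [filter_filter]
  let T : Finset V := ({w | w ≠ r w ∧ b w = u} : Finset V).image o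
  let L : Finset V := if u ≠ r u then {r u} else ∅
  have hT : T ⊆ (s u).1 := by
    intro x hx
    obtain ⟨w, hw, rfl⟩ := mem_image.1 hx
    obtain ⟨hw1, rfl⟩ := (mem_filter.1 hw).2
    exact (hbo w hw1).1
  have hL : ∀ x ∈ L, u ≠ r u ∧ x = r u := by
    intro x hx
    by_cases h : u ≠ r u
    · rw [show L = {r u} from if_pos h] at hx
      exact ⟨h, mem_singleton.1 hx⟩
    · rw [show L = ∅ from if_neg h] at hx
      exact absurd hx (notMem_empty x)
  have huT : u ∉ T ∪ L := by
    rw [mem_union]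
    rintro (h | h)
    · exact (s u).2 (hT h)
    · exact (hL u h).1 (hL u h).2
  refine (hs.le_update u ⟨T ∪ L, huT⟩).trans ?_
  set s' := Function.update s u ⟨T ∪ L, huT⟩ with hs'
  -- Forest edges paid for by other players are untouched, so the whole forest survives the
  -- deviation.
  have htree : ∀ w, w ≠ r w → (graph s').Adj w (p w) := by
    intro w hw
    have h1 : (graph s').Adj (b w) (o w) := by
      rw [hs', graph_update_adj]
      left
      split_ifs with hbu
      · exact mem_union_left _ (mem_image.2 ⟨w, by simp [hw, hbu], rfl⟩)
      · exact (hbo w hw).1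
    rcases (hbo w hw).2 with ⟨hb, ho⟩ | ⟨hb, ho⟩
    · rwa [hb, ho] at h1
    · rw [hb, ho] at h1
      exact h1.symm
  have hsub : ∀ x, x ∈ T ∪ L → (graph s).Reachable u x := by
    intro x hx
    rcases mem_union.1 hx with h | h
    · exact SimpleGraph.Adj.reachable (Or.inl (hT h))
    · rw [(hL x h).2]
      exact hr.reachable u
  -- A newly reachable player could be farther away than `β`, so components must not grow.
  have hreach : ∀ x y, (graph s').Adj x y → (graph s).Reachable x y := by
    intro x y hxy
    rw [hs', graph_update_adj] at hxy
    rcases hxy with h | h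
    · split_ifs at h with hx
      · exact hx ▸ hsub y h
      · exact SimpleGraph.Adj.reachable (Or.inl h)
    · split_ifs at h with hy
      · exact hy ▸ (hsub x h).symm
      · exact SimpleGraph.Adj.reachable (Or.inr h)
  have hdist : ∀ w, penDist β s' u w ≤ (if u ≠ r u then 1 else 0) + penDist β s (r u) w := by
    intro w
    by_cases huw : (graph s).Reachable u w
    · have hrw := hr.eq_of_reachable u w huw
      obtain ⟨q, hq⟩ := hp.exists_walk hr htree w
      rw [penDist_of_reachable ((hr.reachable u).symm.trans huw), hrw, ← hq]
      by_cases hu : u ≠ r u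
      · have hadj : (graph s').Adj u (r w) := by
          rw [hs', graph_update_adj]
          left
          rw [if_pos rfl]
          exact mem_union_right _ (by simp [L, hrw ▸ hu, hrw])
        rw [if_pos (hrw ▸ hu)]
        refine (penDist_le_length (SimpleGraph.Walk.cons hadj q)).trans ?_
        rw [SimpleGraph.Walk.length_cons, Nat.cast_add, Nat.cast_one, add_comm]
      · rw [if_neg (hrw ▸ hu), zero_add]
        have hu' : r w = u := by rw [← hrw]; exact (not_not.1 hu).symm
        exact (congrArg (fun x => penDist β s' x w) hu').symm.trans_le (penDist_le_length q)
    · have h1 : ¬ (graph s').Reachable u w := fun h => huw (reachable_of_reachable_of_adj hreach h)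
      have h2 : ¬ (graph s).Reachable (r u) w := fun h => huw ((hr.reachable u).trans h)
      rw [penDist_of_not_reachable h1, penDist_of_not_reachable h2]
      split_ifs <;> linarith
  have hcard : ((s' u).1.card : ℝ) ≤
      (#{w | w ≠ r w ∧ b w = u} : ℝ) + if u ≠ r u then 1 else 0 := by
    have h1 : (s' u).1 = T ∪ L := by simp [hs']
    have h2 : #L ≤ if u ≠ r u then 1 else 0 := by
      by_cases h : u ≠ r u <;> simp [L, h]
    have h3 := (card_union_le T L).trans (add_le_add card_image_le h2)
    rw [h1]
    exact_mod_cast h3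
  have hsum : ∑ w ∈ univ.erase u, penDist β s' u w ≤
      ((Fintype.card V : ℝ) - 1) * (if u ≠ r u then 1 else 0) + ∑ w, penDist β s (r u) w := by
    rw [← sum_card_univ_erase u]
    refine (sum_le_sum fun w _ => hdist w).trans ?_
    rw [sum_add_distrib]
    exact add_le_add le_rfl (sum_le_sum_of_subset_of_nonneg (erase_subset _ _)
      fun w _ _ => penDist_nonneg hβ _ _)
  rw [playerCost, add_assoc]
  exact add_le_add (mul_le_mul_of_nonneg_left hcard hα.le) hsum

theorem IsStrongEquilibrium.socialCost_le_of_isRootMap (hs : IsStrongEquilibrium α β s)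
    (hα : 0 < α) (hβ : 1 < β) {r : V → V} (hr : IsRootMap (graph s) r) :
    socialCost α β s ≤ (2 * α + ((Fintype.card V : ℝ) - 1)) * (#{w | w ≠ r w} : ℝ) +
      ∑ u, ∑ w, penDist β s (r u) w := by
  obtain ⟨k, hk, h⟩ := hs.playerCost_le_of_isRootMap hα hβ hr
  refine (sum_le_sum fun u _ => h u).trans (le_of_eq ?_)
  have hk' : ∑ u, (k u : ℝ) = #{w | w ≠ r w} := by exact_mod_cast hk
  rw [sum_add_distrib, sum_add_distrib, ← mul_sum, ← mul_sum, sum_add_distrib, hk', sum_boole]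
  ring

theorem IsRootMap.card_nonroot_add_card_root (r : V → V) :
    (#{w | w ≠ r w} : ℝ) + #{w | w = r w} = Fintype.card V := by
  rw [add_comm]
  exact_mod_cast card_filter_add_card_filter_not (s := (univ : Finset V)) (fun w => w = r w)

theorem IsRootMap.card_nonroot_le [Nonempty V] {G : SimpleGraph V} {r : V → V}
    (hr : IsRootMap G r) : (#{w | w ≠ r w} : ℝ) ≤ (Fintype.card V : ℝ) - 1 := by
  obtain ⟨u⟩ := ‹Nonempty V›
  have h1 : 0 < #{w | w = r w} :=
    card_pos.2 ⟨r u, mem_filter.2 ⟨mem_univ _, (hr.root_root u).symm⟩⟩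
  have h2 : (1 : ℝ) ≤ #{w | w = r w} := by exact_mod_cast h1
  linarith [IsRootMap.card_nonroot_add_card_root r]

/-! ### Comparison with the empty network and the star -/

theorem playerCost_of_isolated {i : V} (h : (s i).1 = ∅) (h' : ∀ x, i ∉ (s x).1) :
    playerCost α β s i = ((Fintype.card V : ℝ) - 1) * β := by
  rw [playerCost, h, card_empty, Nat.cast_zero, mul_zero, zero_add, ← sum_card_univ_erase i]
  refine sum_congr rfl fun j hj => penDist_of_not_reachable fun hij => ne_of_mem_erase hj ?_
  refine mem_of_reachable_of_closed (S := {i}) ?_ hij rfl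
  rintro x rfl y (hy | hy)
  · rw [h] at hy
    exact absurd hy (notMem_empty y)
  · exact absurd hy (h' y)

-- If a whole component drops its edges, all its members become isolated; the member that does not
-- gain is `v`.
open Classical in
theorem IsStrongEquilibrium.exists_reachable_playerCost_le (hs : IsStrongEquilibrium α β s)
    (u : V) : ∃ v, (graph s).Reachable u v ∧
      playerCost α β s v ≤ ((Fintype.card V : ℝ) - 1) * β := by
  let s' : State V := fun i => if (graph s).Reachable u i then ⟨∅, notMem_empty i⟩ else s i
  obtain ⟨v, hv, h⟩ := hs.exists_le (C := {i | (graph s).Reachable u i})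
    ⟨u, by simp⟩ s' (fun i hi => if_neg (by simpa using hi))
  have huv : (graph s).Reachable u v := by simpa using hv
  refine ⟨v, huv, h.trans (le_of_eq (playerCost_of_isolated ?_ fun x hx => ?_))⟩
  · simp [s', huv]
  · by_cases hux : (graph s).Reachable u x
    · simp [s', hux] at hx
    · simp only [s', if_neg hux] at hx
      exact hux (huv.trans (SimpleGraph.Adj.reachable (Or.inr hx)))

/-- Let all players who build an edge drop everything. One of them does not gain; it pays at least
`α` now and only penalties afterwards. -/
theorem IsStrongEquilibrium.le_of_nonempty (hs : IsStrongEquilibrium α β s) (hα : 0 < α)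
    (hβ : 1 < β) {u : V} (hu : (s u).1.Nonempty) : α ≤ ((Fintype.card V : ℝ) - 1) * β := by
  let s' : State V := fun i => ⟨∅, notMem_empty i⟩
  obtain ⟨v, hv, h⟩ := hs.exists_le (C := {i | (s i).1.Nonempty})
    ⟨u, by simpa using hu⟩ s'
    (fun i hi => Subtype.ext (by simpa [s', not_nonempty_iff_eq_empty, eq_comm] using hi))
  rw [playerCost_of_isolated (s := s') rfl fun x => notMem_empty v, playerCost_eq] at h
  have h1 : (1 : ℝ) ≤ (s v).1.card := by
    exact_mod_cast card_pos.2 (show (s v).1.Nonempty by simpa using hv)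
  have h2 : 0 ≤ ∑ j, penDist β s v j := sum_nonneg fun j _ => penDist_nonneg hβ _ _
  nlinarith

/-- An equilibrium costs at most four times as much as the empty network. -/
theorem IsStrongEquilibrium.socialCost_le_empty [Nonempty V] (hs : IsStrongEquilibrium α β s)
    (hα : 0 < α) (hβ : 1 < β) : socialCost α β s ≤
      4 * ((Fintype.card V : ℝ) * ((Fintype.card V : ℝ) - 1) * β) := by
  obtain ⟨r, hr, hlow⟩ := exists_isRootMap _ hs.exists_reachable_playerCost_le
  obtain ⟨p, hp⟩ := hr.exists_isParentMap
  have hcost := hs.socialCost_le_of_isRootMap hα hβ hr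
  have hsum : ∑ u, ∑ w, penDist β s (r u) w ≤
      (Fintype.card V : ℝ) * (((Fintype.card V : ℝ) - 1) * β) := by
    refine (sum_le_sum fun u _ => (sum_penDist_le_playerCost hα _).trans (hlow u)).trans ?_
    rw [sum_const, card_univ, nsmul_eq_mul]
  have hm := hr.card_nonroot_le
  have hn : (1 : ℝ) ≤ Fintype.card V := by exact_mod_cast Fintype.card_pos
  set n := (Fintype.card V : ℝ)
  have hbuy : α * (#{w | w ≠ r w} : ℝ) ≤ (n - 1) * β * (n - 1) := by
    rcases (filter (fun w => w ≠ r w) univ).eq_empty_or_nonempty with h | ⟨w, hw⟩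
    · rw [h, card_empty, Nat.cast_zero, mul_zero]
      have : 0 ≤ n - 1 := by linarith
      positivity
    · have hαβ : α ≤ (n - 1) * β := by
        rcases hp.adj w (mem_filter.1 hw).2 with h | h
        · exact hs.le_of_nonempty hα hβ ⟨_, h⟩
        · exact hs.le_of_nonempty hα hβ ⟨_, h⟩
      exact mul_le_mul hαβ hm (Nat.cast_nonneg _) (hα.le.trans hαβ)
  have hdist : (n - 1) * (#{w | w ≠ r w} : ℝ) ≤ (n - 1) * (n - 1) :=
    mul_le_mul_of_nonneg_left hm (by linarith)
  have h1 : (n - 1) * (n - 1) ≤ (n - 1) * (n - 1) * β :=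
    le_mul_of_one_le_right (mul_self_nonneg _) hβ.le
  have h2 : 0 ≤ (n - 1) * β := mul_nonneg (by linarith) (by linarith)
  nlinarith

theorem playerCost_starState_le (hα : 0 < α) (hn : 2 ≤ Fintype.card V) (c i : V) :
    playerCost α β (starState c) i ≤ α + 2 * (Fintype.card V : ℝ) - 3 := by
  have hn' : (2 : ℝ) ≤ Fintype.card V := by exact_mod_cast hn
  rw [playerCost]
  by_cases hi : i = c
  · subst hi
    have h : ∀ j ∈ univ.erase i, penDist β (starState i) i j ≤ 1 := fun j hj => by
      simpa using penDist_le_length (β := β) (starState_adj (ne_of_mem_erase hj)).symm.toWalk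
    have h1 := sum_le_sum h
    rw [sum_card_univ_erase] at h1
    simp only [starState, dite_true, card_empty, Nat.cast_zero, mul_zero]
    linarith
  · have h : ∀ j ∈ univ.erase i, penDist β (starState c) i j ≤ 2 - if j = c then 1 else 0 := by
      intro j hj
      by_cases hjc : j = c
      · subst hjc
        have := penDist_le_length (β := β) (starState_adj hi).toWalk
        norm_num at this ⊢
        exact this
      · have := penDist_le_length (β := β)
          (SimpleGraph.Walk.cons (starState_adj hi) (starState_adj hjc).symm.toWalk)
        rw [if_neg hjc]
        norm_num at this ⊢
        exact this
    have h1 := sum_le_sum h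
    rw [sum_sub_distrib, sum_card_univ_erase, sum_ite_eq',
      if_pos (mem_erase.2 ⟨Ne.symm hi, mem_univ c⟩)] at h1
    simp only [starState, dif_neg hi, card_singleton, Nat.cast_one, mul_one]
    linarith

open Classical in
/-- An equilibrium costs at most four times as much as a star. -/
theorem IsStrongEquilibrium.socialCost_le_star (hs : IsStrongEquilibrium α β s)
    (hα : 0 < α) (hβ : 1 < β) (hn : 2 ≤ Fintype.card V) : socialCost α β s ≤
      4 * (((Fintype.card V : ℝ) - 1) * (α + 2 * ((Fintype.card V : ℝ) - 1))) := by
  have : Nonempty V := Fintype.card_pos_iff.1 (by omega)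
  obtain ⟨v, -, hv⟩ := hs.exists_le (C := univ) univ_nonempty
    (starState (Classical.arbitrary V)) (fun i hi => absurd (mem_univ i) hi)
  replace hv := (sum_penDist_le_playerCost hα v).trans
    (hv.trans (playerCost_starState_le hα hn _ v))
  -- The root of the component of `v` is at least as central as `v`; any other root is a player that
  -- would not gain from dissolving its component.
  obtain ⟨r, hr, hlow⟩ := exists_isRootMap (G := graph s)
    (fun x => ∑ w, penDist β s x w ≤
      if (graph s).Reachable x v then ∑ w, penDist β s v w else ((Fintype.card V : ℝ) - 1) * β)
    (fun u => by
      by_cases huv : (graph s).Reachable u v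
      · exact ⟨v, huv, by simp⟩
      · obtain ⟨x, hx, hcost⟩ := hs.exists_reachable_playerCost_le u
        refine ⟨x, hx, ?_⟩
        rw [if_neg fun hxv => huv (hx.trans hxv)]
        exact (sum_penDist_le_playerCost hα x).trans hcost)
  have hcost := hs.socialCost_le_of_isRootMap hα hβ hr
  have hm := hr.card_nonroot_le
  have hn' : (2 : ℝ) ≤ Fintype.card V := by exact_mod_cast hn
  have hab : (#{u | (graph s).Reachable u v} : ℝ) + #{u | ¬ (graph s).Reachable u v} =
      Fintype.card V := by
    exact_mod_cast card_filter_add_card_filter_not (s := (univ : Finset V))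
      (fun u => (graph s).Reachable u v)
  have hsum : ∑ u, ∑ w, penDist β s (r u) w ≤
      #{u | (graph s).Reachable u v} * ∑ w, penDist β s v w +
        #{u | ¬ (graph s).Reachable u v} * (((Fintype.card V : ℝ) - 1) * β) := by
    rw [← nsmul_eq_mul, ← nsmul_eq_mul, ← sum_const, ← sum_const, ← sum_ite]
    refine sum_le_sum fun u _ => (hlow u).trans (le_of_eq ?_)
    exact if_congr ⟨fun h => (hr.reachable u).trans h, fun h => (hr.reachable u).symm.trans h⟩
      rfl rfl
  -- Players outside the component of `v` each cost `v` the penalty, so the bound for `v` also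
  -- controls the other components.
  have hpen : #{u | ¬ (graph s).Reachable u v} * β ≤ ∑ w, penDist β s v w := by
    rw [← nsmul_eq_mul, ← sum_const, sum_filter]
    refine sum_le_sum fun w _ => ?_
    split_ifs with h
    · exact penDist_nonneg hβ _ _
    · exact (penDist_of_not_reachable fun h' => h h'.symm).ge
  have hb : #{u | ¬ (graph s).Reachable u v} = 0 ∨
      (1 : ℝ) ≤ #{u | ¬ (graph s).Reachable u v} := by
    rcases Nat.eq_zero_or_pos #{u | ¬ (graph s).Reachable u v} with h | h
    · exact Or.inl h
    · exact Or.inr (by exact_mod_cast h)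
  have hQ : 0 ≤ ∑ w, penDist β s v w := sum_nonneg fun w _ => penDist_nonneg hβ _ _
  have htotal : ∑ u, ∑ w, penDist β s (r u) w ≤
      2 * ((Fintype.card V : ℝ) - 1) * ∑ w, penDist β s v w := by
    refine hsum.trans ?_
    -- A connected network needs `n ≤ 2(n-1)`, which is where `n ≥ 2` enters; otherwise the
    -- component of `v` has at most `n - 1` players.
    rcases hb with hb | hb
    · rw [hb] at hab ⊢
      rw [Nat.cast_zero] at hab ⊢
      nlinarith
    · have h1 := mul_le_mul_of_nonneg_left hpen (by linarith : 0 ≤ (Fintype.card V : ℝ) - 1)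
      have h2 := mul_le_mul_of_nonneg_right
        (by linarith : (#{u | (graph s).Reachable u v} : ℝ) ≤ (Fintype.card V : ℝ) - 1) hQ
      linarith
  set n := (Fintype.card V : ℝ)
  have h1 := mul_le_mul_of_nonneg_left hm (by linarith : 0 ≤ 2 * α + (n - 1))
  have h2 := mul_le_mul_of_nonneg_left hv (by linarith : 0 ≤ 2 * (n - 1))
  nlinarith

/-! ### Comparison with the complete network -/

/-- The link costs at most `α` and brings `v` to distance 1; if it lengthens no distance, the saving
on `v` alone cannot exceed `α`. -/
theorem IsStrongEquilibrium.penDist_le_of_link (hs : IsStrongEquilibrium α β s) (hα : 0 < α)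
    {u v : V} (h : u ≠ v) (hle : ∀ w, penDist β (link s u v h) u w ≤ penDist β s u w) :
    penDist β s u v ≤ 1 + α := by
  have h1 : playerCost α β s u ≤ playerCost α β (link s u v h) u := hs.le_update u _
  rw [playerCost_eq, playerCost_eq] at h1
  have h2 : ((link s u v h u).1.card : ℝ) ≤ (s u).1.card + 1 := by
    have : (link s u v h u).1 = insert v (s u).1 := by simp [link]
    rw [this]
    exact_mod_cast card_insert_le _ _
  have h3 : penDist β s u v - penDist β (link s u v h) u v ≤
      ∑ w, (penDist β s u w - penDist β (link s u v h) u w) :=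
    single_le_sum (f := fun w => penDist β s u w - penDist β (link s u v h) u w)
      (fun w _ => sub_nonneg.2 (hle w)) (mem_univ v)
  rw [sum_sub_distrib] at h3
  have h4 : penDist β (link s u v h) u v ≤ 1 := by
    simpa using penDist_le_length (β := β) (adj_link s h).toWalk
  nlinarith

theorem IsStrongEquilibrium.penDist_le_of_reachable (hs : IsStrongEquilibrium α β s)
    (hα : 0 < α) {u v : V} (huv : (graph s).Reachable u v) : penDist β s u v ≤ 1 + α := by
  by_cases h : u = v
  · rw [h, penDist_self]
    linarith
  refine hs.penDist_le_of_link hα h fun w => ?_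
  by_cases hw : (graph s).Reachable u w
  · exact penDist_link_le h hw
  · rw [penDist_of_not_reachable hw, penDist_of_not_reachable]
    exact fun h' => (reachable_or_of_reachable_link h h').elim hw fun h'' => hw (huv.trans h'')

/-- For different components, suppose `β > 2 + α`. Linking to `v` brings its component within `1 +
(1 + α) < β`, so no distance grows and `penDist_le_of_link` gives a contradiction. -/
theorem IsStrongEquilibrium.penDist_le (hs : IsStrongEquilibrium α β s) (hα : 0 < α) (u v : V) :
    penDist β s u v ≤ 2 + α := by
  by_cases huv : (graph s).Reachable u v
  · linarith [hs.penDist_le_of_reachable hα huv]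
  have h : u ≠ v := fun h => huv (h ▸ SimpleGraph.Reachable.refl u)
  by_contra! hlt
  have hβ := penDist_of_not_reachable (β := β) huv
  refine absurd (hs.penDist_le_of_link hα h fun w => ?_) (by linarith)
  by_cases hw : (graph s).Reachable u w
  · exact penDist_link_le h hw
  rw [penDist_of_not_reachable hw]
  by_cases hvw : (graph s).Reachable v w
  · obtain ⟨q, hq⟩ := hvw.exists_walk_length_eq_dist
    have h1 := hs.penDist_le_of_reachable hα hvw
    rw [penDist_of_reachable hvw, ← hq] at h1
    have h2 := penDist_le_length (β := β)
      (SimpleGraph.Walk.cons (adj_link s h) (q.mapLe (graph_le_link s h)))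
    rw [SimpleGraph.Walk.length_cons, SimpleGraph.Walk.length_mapLe, Nat.cast_add,
      Nat.cast_one] at h2
    linarith
  · exact (penDist_of_not_reachable fun h' =>
      (reachable_or_of_reachable_link h h').elim hw hvw).le

/-- An equilibrium costs at most four times as much as the complete network. -/
theorem IsStrongEquilibrium.socialCost_le_complete (hs : IsStrongEquilibrium α β s)
    (hα : 0 < α) : socialCost α β s ≤
      4 * ((Fintype.card V : ℝ) * ((Fintype.card V : ℝ) - 1) * (1 + α / 2)) := by
  have h : ∀ u, playerCost α β s u ≤ ((Fintype.card V : ℝ) - 1) * (4 + 2 * α) := fun u => by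
    have h1 : ((s u).1.card : ℝ) ≤ (Fintype.card V : ℝ) - 1 := by
      rw [← mul_one ((Fintype.card V : ℝ) - 1), ← sum_card_univ_erase u, sum_const, nsmul_one]
      exact_mod_cast card_le_card fun x hx =>
        mem_erase.2 ⟨ne_of_mem_of_not_mem hx (s u).2, mem_univ x⟩
    have h2 : ∑ j ∈ univ.erase u, penDist β s u j ≤ ((Fintype.card V : ℝ) - 1) * (2 + α) := by
      rw [← sum_card_univ_erase u]
      exact sum_le_sum fun j _ => hs.penDist_le hα u j
    have h3 : (0 : ℝ) ≤ (s u).1.card := Nat.cast_nonneg _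
    rw [playerCost]
    nlinarith
  refine (sum_le_sum fun u _ => h u).trans (le_of_eq ?_)
  rw [sum_const, card_univ, nsmul_eq_mul]
  ring

/-! ### Lower bounds for arbitrary states -/

theorem socialCost_eq : socialCost α β t =
    α * ∑ u, ((t u).1.card : ℝ) + ∑ u, ∑ w ∈ univ.erase u, penDist β t u w := by
  rw [mul_sum, ← sum_add_distrib]
  rfl

open Classical in
theorem sum_adj_le (t : State V) :
    ∑ u, ∑ w ∈ univ.erase u, (if (graph t).Adj u w then (1 : ℝ) else 0) ≤
      2 * ∑ u, ((t u).1.card : ℝ) := by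
  have h1 : ∑ u, ∑ w, (if w ∈ (t u).1 then (1 : ℝ) else 0) = ∑ u, ((t u).1.card : ℝ) :=
    sum_congr rfl fun u _ => by rw [sum_boole, filter_univ_mem]
  have h2 : ∑ u, ∑ w, (if u ∈ (t w).1 then (1 : ℝ) else 0) = ∑ u, ((t u).1.card : ℝ) := by
    rw [sum_comm, h1]
  rw [two_mul]
  nth_rw 1 [← h1]
  rw [← h2, ← sum_add_distrib]
  refine sum_le_sum fun u _ => ?_
  rw [← sum_add_distrib]
  refine (sum_le_sum_of_subset_of_nonneg (erase_subset u univ) fun w _ _ => ?_).trans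
    (sum_le_sum fun w _ => ?_)
  · split_ifs <;> norm_num
  · by_cases hu : w ∈ (t u).1 <;> by_cases hw : u ∈ (t w).1 <;> simp [graph, hu, hw]

-- Each adjacent ordered pair is charged `α/2`, so an edge is charged at most `α` in total.
open Classical in
theorem le_socialCost_of_forall_pair (hα : 0 < α) {c : ℝ}
    (h : ∀ u w, u ≠ w → c ≤ α / 2 * (if (graph t).Adj u w then 1 else 0) + penDist β t u w) :
    (Fintype.card V : ℝ) * ((Fintype.card V : ℝ) - 1) * c ≤ socialCost α β t := by
  have h1 : ∑ u : V, ∑ w ∈ univ.erase u, c ≤ ∑ u, ∑ w ∈ univ.erase u,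
      (α / 2 * (if (graph t).Adj u w then 1 else 0) + penDist β t u w) :=
    sum_le_sum fun u _ => sum_le_sum fun w hw => h u w (ne_of_mem_erase hw).symm
  simp only [sum_card_univ_erase] at h1
  simp only [sum_const, card_univ, nsmul_eq_mul, sum_add_distrib, ← mul_sum] at h1
  rw [socialCost_eq]
  linarith [mul_le_mul_of_nonneg_left (sum_adj_le t) (by linarith : 0 ≤ α / 2)]

theorem IsRootMap.card_nonroot_le_sum_card {r : V → V} (hr : IsRootMap (graph t) r) :
    (#{w | w ≠ r w} : ℝ) ≤ ∑ u, ((t u).1.card : ℝ) := by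
  obtain ⟨p, hp⟩ := hr.exists_isParentMap
  obtain ⟨b, o, hbo⟩ := hp.exists_builder
  have h : #{w | w ≠ r w} ≤ #(univ.sigma fun u => (t u).1) := by
    refine card_le_card_of_injOn (fun w => (⟨b w, o w⟩ : Σ _ : V, V)) (fun w hw => ?_) ?_
    · have hw' : w ≠ r w := by simpa using hw
      simpa using (hbo w hw').1
    · intro w hw x hx hwx
      have hw' : w ≠ r w := by simpa using hw
      have hx' : x ≠ r x := by simpa using hx
      obtain ⟨hb, ho⟩ : b w = b x ∧ o w = o x := by simpa using hwx
      -- Two players cannot be each other's parent: each would be strictly closer to the common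
      -- root.
      have key : p w = x → w = p x → w = x := fun h1 h2 => by
        exfalso
        have d1 := hp.dist w hw'
        have d2 := hp.dist x hx'
        have e := hr.eq_of_reachable _ _ (hp.adj w hw').reachable
        rw [h1] at d1 e
        rw [← h2, ← e] at d2
        omega
      rcases (hbo w hw').2 with ⟨h1, h2⟩ | ⟨h1, h2⟩ <;>
        rcases (hbo x hx').2 with ⟨h3, h4⟩ | ⟨h3, h4⟩
      · exact h1.symm.trans (hb.trans h3)
      · exact key (h2.symm.trans (ho.trans h4)) (h1.symm.trans (hb.trans h3))
      · exact key (h1.symm.trans (hb.trans h3)) (h2.symm.trans (ho.trans h4))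
      · exact h2.symm.trans (ho.trans h4)
  rw [card_sigma] at h
  exact_mod_cast h

open Classical in
theorem IsRootMap.le_card_not_reachable {G : SimpleGraph V} {r : V → V} (hr : IsRootMap G r)
    (u : V) : (Fintype.card V : ℝ) - 1 - #{w | w ≠ r w} ≤ #{w ∈ univ.erase u | ¬ G.Reachable u w} := by
  have h1 : ({w | w = r w} : Finset V).erase (r u) ⊆
      ({w ∈ univ.erase u | ¬ G.Reachable u w} : Finset V) := by
    intro w hw
    obtain ⟨hne, hw⟩ := mem_erase.1 hw
    have hw' : w = r w := (mem_filter.1 hw).2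
    have hnr : ¬ G.Reachable u w := fun h => hne (hw'.trans (hr.eq_of_reachable u w h).symm)
    refine mem_filter.2 ⟨mem_erase.2 ⟨fun h => hnr (h ▸ SimpleGraph.Reachable.refl _),
      mem_univ w⟩, hnr⟩
  have h2 := card_le_card h1
  have h3 := pred_card_le_card_erase (s := ({w | w = r w} : Finset V)) (a := r u)
  have h4 : (#{w | w = r w} : ℝ) ≤ #{w ∈ univ.erase u | ¬ G.Reachable u w} + 1 := by
    exact_mod_cast (by omega : #{w | w = r w} ≤ #{w ∈ univ.erase u | ¬ G.Reachable u w} + 1)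
  linarith [IsRootMap.card_nonroot_add_card_root r]

-- Split `α = 2 + (α - 2)`. The part 2 lifts adjacent pairs to cost 2, so every pair costs at least
-- 2, or `β` if disconnected. The rest is paid on at least as many edges as the forest has. All
-- roots but its own are unreachable from a player.
open Classical in
theorem IsRootMap.le_socialCost {r : V → V} (hr : IsRootMap (graph t) r) (hα : 2 ≤ α)
    (hβ : 2 ≤ β) : (α - 2) * (#{w | w ≠ r w} : ℝ) + (Fintype.card V : ℝ) *
      (((Fintype.card V : ℝ) - 1) * 2 +
        (β - 2) * ((Fintype.card V : ℝ) - 1 - #{w | w ≠ r w})) ≤ socialCost α β t := by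
  have hpair : ∀ u w, u ≠ w → 2 + (β - 2) * (if ¬ (graph t).Reachable u w then 1 else 0) ≤
      (if (graph t).Adj u w then 1 else 0) + penDist β t u w := by
    intro u w huw
    by_cases hreach : (graph t).Reachable u w
    · rw [if_neg (not_not.2 hreach)]
      split_ifs with hadj
      · linarith [one_le_penDist (s := t) (by linarith : 1 < β) huw]
      · rw [penDist_of_reachable hreach]
        have : (2 : ℝ) ≤ (graph t).dist u w := by
          exact_mod_cast two_le_dist_of_not_adj huw hreach hadj
        linarith
    · rw [if_pos hreach, penDist_of_not_reachable hreach]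
      split_ifs <;> linarith
  have hplayer : ∀ u, ((Fintype.card V : ℝ) - 1) * 2 +
      (β - 2) * ((Fintype.card V : ℝ) - 1 - #{w | w ≠ r w}) ≤
      ∑ w ∈ univ.erase u, ((if (graph t).Adj u w then 1 else 0) + penDist β t u w) := fun u => by
    refine le_trans ?_ (sum_le_sum fun w hw => hpair u w (ne_of_mem_erase hw).symm)
    rw [sum_add_distrib, sum_card_univ_erase, ← mul_sum, sum_boole]
    exact add_le_add le_rfl (mul_le_mul_of_nonneg_left (hr.le_card_not_reachable u)
      (by linarith))
  have hall := sum_le_sum (s := univ) fun u _ => hplayer u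
  simp only [sum_const, card_univ, nsmul_eq_mul, sum_add_distrib] at hall
  rw [socialCost_eq]
  have hE := mul_le_mul_of_nonneg_left hr.card_nonroot_le_sum_card (by linarith : 0 ≤ α - 2)
  linarith [sum_adj_le t]

theorem socialCost_nonneg (hα : 0 < α) (hβ : 1 < β) : 0 ≤ socialCost α β t :=
  sum_nonneg fun u _ =>
    (sum_nonneg fun w _ => penDist_nonneg hβ u w).trans (sum_penDist_le_playerCost hα u)

/-- A strong equilibrium costs at most four times as much as any other state. -/
theorem IsStrongEquilibrium.socialCost_le (hs : IsStrongEquilibrium α β s) (hα : 0 < α)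
    (hβ : 1 < β) (t : State V) : socialCost α β s ≤ 4 * socialCost α β t := by
  rcases le_or_gt (Fintype.card V) 1 with hn | hn
  · have : Subsingleton V := Fintype.card_le_one_iff_subsingleton.1 hn
    have hst : s = t := by
      have hempty : ∀ (s : State V) i, (s i).1 = ∅ := fun s i => eq_empty_of_forall_notMem
        fun x hx => (s i).2 (Subsingleton.elim x i ▸ hx)
      funext i
      exact Subtype.ext ((hempty s i).trans (hempty t i).symm)
    rw [hst]
    linarith [socialCost_nonneg (t := t) hα hβ]
  have : Nonempty V := Fintype.card_pos_iff.1 (by omega)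
  classical
  by_cases hcomplete : α ≤ 2 ∧ 1 + α / 2 ≤ β
  · refine (hs.socialCost_le_complete hα).trans (mul_le_mul_of_nonneg_left
      (le_socialCost_of_forall_pair hα fun u w huw => ?_) (by norm_num))
    by_cases hreach : (graph t).Reachable u w
    · split_ifs with hadj
      · linarith [one_le_penDist (s := t) hβ huw]
      · rw [penDist_of_reachable hreach]
        have : (2 : ℝ) ≤ (graph t).dist u w := by
          exact_mod_cast two_le_dist_of_not_adj huw hreach hadj
        linarith
    · rw [penDist_of_not_reachable hreach]
      split_ifs <;> linarith
  by_cases hβ2 : β ≤ 2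
  · have hβα : β ≤ 1 + α / 2 := by
      by_contra! h
      exact hcomplete ⟨by linarith, h.le⟩
    refine (hs.socialCost_le_empty hα hβ).trans (mul_le_mul_of_nonneg_left
      (le_socialCost_of_forall_pair hα fun u w huw => ?_) (by norm_num))
    by_cases hreach : (graph t).Reachable u w
    · split_ifs with hadj
      · linarith [one_le_penDist (s := t) hβ huw]
      · rw [penDist_of_reachable hreach]
        have : (2 : ℝ) ≤ (graph t).dist u w := by
          exact_mod_cast two_le_dist_of_not_adj huw hreach hadj
        linarith
    · rw [penDist_of_not_reachable hreach]
      split_ifs <;> linarith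
  · push Not at hβ2
    have hα2 : 2 ≤ α := by
      by_contra! h
      exact hcomplete ⟨h.le, by linarith⟩
    obtain ⟨r, hr, -⟩ := exists_isRootMap (G := graph t) (fun _ => True)
      fun u => ⟨u, SimpleGraph.Reachable.refl u, trivial⟩
    have hlow := hr.le_socialCost hα2 hβ2.le
    have hm := hr.card_nonroot_le
    have hstar := hs.socialCost_le_star hα hβ hn
    have hempty := hs.socialCost_le_empty hα hβ
    have hn' : (1 : ℝ) < Fintype.card V := by exact_mod_cast hn
    have hm0 : (0 : ℝ) ≤ #{w | w ≠ r w} := Nat.cast_nonneg _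
    generalize (#{w | w ≠ r w} : ℝ) = m at *
    generalize (Fintype.card V : ℝ) = n at *
    -- Weights `m` and `n - 1 - m` on the star and empty bounds add up to exactly `n - 1` times the
    -- affine lower bound.
    have h1 := mul_le_mul_of_nonneg_left hstar hm0
    have h2 := mul_le_mul_of_nonneg_left hempty (by linarith : 0 ≤ n - 1 - m)
    have h3 := mul_le_mul_of_nonneg_left hlow (by linarith : 0 ≤ n - 1)
    refine le_of_mul_le_mul_left ?_ (by linarith : 0 < n - 1)
    linarith

end Game

end PCG

theorem mainTheorem1 {V : Type*} [Fintype V] [DecidableEq V] (α β : ℝ) (hα : 0 < α) (hβ : 1 < β)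
    (s sOpt : PCG.State V) (hs : PCG.IsStrongEquilibrium α β s)
    (hOpt : PCG.IsSocialOptimum α β sOpt) :
    PCG.socialCost α β s ≤ 4 * PCG.socialCost α β sOpt := hs.socialCost_le hα hβ sOpt
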